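/- Let $q$ be an odd prime power and let $\mathbb F_q$ be the field with $q$ elements. Let $s(4,q)$ be the number of elements of $SL_2(\mathbb F_q)$ of the form $x^4$ with $x\in SL_2(\mathbb F_q)$, and let $c(4,q)$ be the number of conjugacy classes of $SL_2(\mathbb F_q)$ consisting of such elements. Then $$ s(4,q) = \begin{cases} \frac{3}{8}q^3 - \frac{1}{2}q^2 - \frac{7}{8}q + 1, & q\equiv 1 \pmod 8,\\ \frac{3}{8}(q^3-q), & q\equiv 3 \text{ or } 5 \pmod 8,\\ \frac{3}{8}q^3 - \frac{1}{2}q^2 + \frac{1}{8}q + 1, & q\equiv 7 \pmod 8, \end{cases} $$ and $$ c(4,q) = \begin{cases} \frac{3q+21}{8}, & q\equiv 1 \pmod 8,\\ \frac{3q+15}{8}, & q\equiv 3 \pmod 8,\\ \frac{3q+17}{8}, & q\equiv 5 \pmod 8,\\ \frac{3q+19}{8}, & q\equiv 7 \pmod 8. \end{cases} $$ Consequently, as $q\to\infty$ through the odd prime powers, both the proportion $s(4,q)/|SL_2(\mathbb F_q)|$ of fourth powers and the proportion of the conjugacy classes of $SL_2(\mathbb F_q)$ that consist of fourth powers, i.e.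 $c(4,q)$ divided by the total number of conjugacy classes of $SL_2(\mathbb F_q)$, tend to $\frac{3}{8}$. -/

import Mathlib

/-- The set `G ^ n = {x ^ n | x ∈ G}` of `n`-th powers in a group `G`. -/
def nthPowers (G : Type*) [Group G] (n : ℕ) : Set G := {g | ∃ x : G, x ^ n = g}

/-- The set of conjugacy classes of `G` that are `n`-th powers, that is, the classes of the
`n`-th powers in `G` (being an `n`-th power is invariant under conjugation). -/
def nthPowerClasses (G : Type*) [Group G] (n : ℕ) : Set (ConjClasses G) :=
  {C | ∃ g ∈ nthPowers G n, ConjClasses.mk g = C}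

/-- The group `SL₂(F)`. -/
abbrev SL2 (F : Type*) [Field F] : Type _ := Matrix.SpecialLinearGroup (Fin 2) F

/-- `s(n, q)`: the number of `n`-th powers in `SL₂(F)`, where `F` is a field with `q` elements. -/
noncomputable def powerCount (n : ℕ) (F : Type*) [Field F] : ℕ :=
  (nthPowers (SL2 F) n).ncard

/-- `c(n, q)`: the number of conjugacy classes of `SL₂(F)` that are `n`-th powers, where `F` is
a field with `q` elements. -/
noncomputable def powerClassCount (n : ℕ) (F : Type*) [Field F] : ℕ :=
  (nthPowerClasses (SL2 F) n).ncard

/-! Write `C_n`, `S_n` for the rescaled Chebyshev polynomials. If `x ∈ SL₂` has trace `s`, then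
Cayley–Hamilton gives `x ^ n = S_{n-1}(s) x - S_{n-2}(s)` and `tr (x ^ n) = C_n(s)`. Conversely, if
`tr g = C_n(s)` and `S_{n-1}(s) ≠ 0`, then `g` is the `n`-th power of
`(g + S_{n-2}(s)) / S_{n-1}(s)`. Since `C_n² - 4 = S_{n-1}² (s² - 4)`, being an `n`-th power depends
only on the trace away from the traces `±2`, and `C_n` preserves the quadratic character of
`t² - 4` as long as `C_n(t) ≠ ±2`.

It remains to count traces: the elements of trace `t` number `q² + q χ(t² - 4)`, and they form a
single conjugacy class if `t ≠ ±2` and three classes otherwise. For `n = 4` and `C_4(s) ≠ ±2`, the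
fibre of `C_4` through `s` is `{x | x² = s²} ∪ {x | x² = 4 - s²}`, of size `3 + χ(-1) χ(s² - 4)`. -/

section

open Finset Polynomial
open Polynomial.Chebyshev (C S)
open scoped MatrixGroups

section Powers

variable {R : Type*} [CommRing R]

theorem sq_eq_trace_smul_sub_one {M : Matrix (Fin 2) (Fin 2) R} (hM : M.det = 1) :
    M ^ 2 = M.trace • M - 1 := by
  nontriviality R
  have h := M.aeval_self_charpoly
  rw [Matrix.charpoly_fin_two, hM] at h
  simp only [map_add, map_sub, map_pow, map_mul, aeval_X, aeval_C, map_one,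
    ← Algebra.smul_def] at h
  rw [← sub_eq_zero, ← h]
  abel

theorem pow_eq_eval_S_smul_sub {M : Matrix (Fin 2) (Fin 2) R} (hM : M.det = 1) (n : ℕ) :
    M ^ n = (S R (n - 1)).eval M.trace • M - (S R (n - 2)).eval M.trace • 1 := by
  induction n with
  | zero => simp
  | succ n ih =>
    have hS : (S R n).eval M.trace =
        M.trace * (S R (n - 1)).eval M.trace - (S R (n - 2)).eval M.trace := by
      rw [Chebyshev.S_eq]; simp
    rw [pow_succ, ih, sub_mul, smul_mul_assoc, ← sq, sq_eq_trace_smul_sub_one hM, smul_one_mul,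
      Nat.cast_succ, show (n : ℤ) + 1 - 1 = n by ring, show (n : ℤ) + 1 - 2 = n - 1 by ring, hS]
    module

theorem eval_C_eq (n : ℤ) (s : R) :
    (C R n).eval s = s * (S R (n - 1)).eval s - 2 * (S R (n - 2)).eval s := by
  rw [Chebyshev.C_eq_S_sub_X_mul_S, Chebyshev.S_eq]
  simp only [eval_sub, eval_mul, eval_ofNat, eval_X]
  ring

theorem trace_pow_eq_eval_C {M : Matrix (Fin 2) (Fin 2) R} (hM : M.det = 1) (n : ℕ) :
    (M ^ n).trace = (C R n).eval M.trace := by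
  rw [pow_eq_eval_S_smul_sub hM, eval_C_eq]
  simp [mul_comm]

theorem eval_S_sq_add_eval_S_sq (n : ℤ) (s : R) :
    (S R (n - 2)).eval s ^ 2 + (S R (n - 1)).eval s ^ 2
      - s * (S R (n - 2)).eval s * (S R (n - 1)).eval s = 1 := by
  have h := congrArg (eval s) (Chebyshev.S_sq_add_S_sq R (n - 2))
  rw [show n - 2 + 1 = n - 1 by ring] at h
  simpa using h

theorem eval_C_sq_sub_four (n : ℤ) (s : R) :
    (C R n).eval s ^ 2 - 4 = (S R (n - 1)).eval s ^ 2 * (s ^ 2 - 4) := by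
  rw [eval_C_eq]
  linear_combination 4 * eval_S_sq_add_eval_S_sq n s

variable {F : Type*} [Field F]

theorem mem_nthPowers_of_trace_eq_eval_C {n : ℕ} {g : SL2 F} {s : F}
    (hS : (S F (n - 1)).eval s ≠ 0) (hg : g.1.trace = (C F n).eval s) :
    g ∈ nthPowers (SL2 F) n := by
  have hk := eval_S_sq_add_eval_S_sq (n : ℤ) s
  rw [eval_C_eq] at hg
  set k := (S F (n - 1)).eval s with hk_def
  set b := (S F (n - 2)).eval s with hb_def
  let M : Matrix (Fin 2) (Fin 2) F := k⁻¹ • (g.1 + b • 1)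
  have htrace : M.trace = s := by
    simp only [M, Matrix.trace_smul, Matrix.trace_add, hg, Matrix.trace_one, Fintype.card_fin,
      smul_eq_mul]
    field_simp
    push_cast
    ring
  have hdet : M.det = 1 := by
    have hgdet := g.2
    rw [Matrix.det_fin_two] at hgdet
    rw [Matrix.trace_fin_two] at hg
    simp only [M, Matrix.det_fin_two, Matrix.smul_apply, Matrix.add_apply, Matrix.one_fin_two,
      smul_eq_mul, Matrix.of_apply, Matrix.cons_val]
    field_simp
    linear_combination hgdet + b * hg - hk
  refine ⟨⟨M, hdet⟩, Subtype.ext ?_⟩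
  change M ^ n = g.1
  rw [pow_eq_eval_S_smul_sub hdet, htrace, ← hk_def, ← hb_def, smul_inv_smul₀ hS,
    add_sub_cancel_right]

theorem exists_eval_C_eq_trace {n : ℕ} {g : SL2 F} (hg : g ∈ nthPowers (SL2 F) n) :
    ∃ s, (C F n).eval s = g.1.trace := by
  obtain ⟨x, rfl⟩ := hg
  exact ⟨x.1.trace, (trace_pow_eq_eval_C x.2 n).symm⟩

theorem mem_nthPowers_iff_of_trace_sq_sub_four_ne_zero {n : ℕ} {g : SL2 F}
    (hg : g.1.trace ^ 2 - 4 ≠ 0) :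
    g ∈ nthPowers (SL2 F) n ↔ ∃ s, (C F n).eval s = g.1.trace := by
  refine ⟨exists_eval_C_eq_trace, fun ⟨s, hs⟩ => mem_nthPowers_of_trace_eq_eval_C ?_ hs.symm⟩
  rw [← hs, eval_C_sq_sub_four] at hg
  exact (pow_ne_zero_iff two_ne_zero).1 (left_ne_zero_of_mul hg)

theorem mem_nthPowers_of_trace_eq_two {n : ℕ} (hn : (n : F) ≠ 0) {g : SL2 F}
    (hg : g.1.trace = 2) : g ∈ nthPowers (SL2 F) n :=
  mem_nthPowers_of_trace_eq_eval_C (s := 2) (by simpa using hn) (by simpa using hg)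

end Powers

section FourthPowers

variable {R : Type*} [CommRing R]

theorem eval_S_three (s : R) : (S R 3).eval s = s * (s ^ 2 - 2) := by
  rw [show (3 : ℤ) = 1 + 2 by norm_num, Chebyshev.S_add_two]
  simp only [Int.reduceAdd, Chebyshev.S_two, Chebyshev.S_one, eval_sub, eval_mul, eval_X, eval_pow,
    eval_one]
  ring

theorem eval_C_four (s : R) : (C R 4).eval s = s ^ 4 - 4 * s ^ 2 + 2 := by
  rw [show (4 : ℤ) = 2 + 2 by norm_num, Chebyshev.C_add_two, Chebyshev.C_add_one]
  simp only [Chebyshev.C_two, Int.reduceSub, Chebyshev.C_one, eval_sub, eval_mul, eval_X, eval_pow,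
    eval_ofNat]
  ring

theorem pow_four_eq_neg_one_of_trace_sq_eq_two {x : SL(2, R)} (hx : x.1.trace ^ 2 = 2) :
    x ^ 4 = -1 := by
  apply Subtype.ext
  rw [Matrix.SpecialLinearGroup.coe_pow, pow_eq_eval_S_smul_sub x.2]
  norm_num [eval_S_three, Chebyshev.S_two, hx, Matrix.SpecialLinearGroup.coe_neg]

theorem trace_pow_four_eq_neg_two_iff [IsReduced R] {x : SL(2, R)} :
    (x ^ 4).1.trace = -2 ↔ x.1.trace ^ 2 = 2 := by
  have hsq : x.1.trace ^ 4 - 4 * x.1.trace ^ 2 + 2 - -2 = (x.1.trace ^ 2 - 2) ^ 2 := by ring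
  rw [Matrix.SpecialLinearGroup.coe_pow, trace_pow_eq_eval_C x.2, Nat.cast_ofNat, eval_C_four,
    ← sub_eq_zero, hsq, pow_eq_zero_iff two_ne_zero, sub_eq_zero]

end FourthPowers

section Conjugacy

open scoped Matrix

variable {R : Type*} [CommRing R]

/-- The companion matrix of `X ^ 2 - t X + 1` in a basis rescaled by `d`. Over a field, these
matrices represent all the conjugacy classes of noncentral elements of trace `t`. -/
def companionSL (d : Rˣ) (t : R) : SL(2, R) :=
  ⟨!![0, -↑d⁻¹; ↑d, t], by simp [Matrix.det_fin_two_of]⟩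

/-- The binary quadratic form `v ↦ det (v, g v)`. It vanishes exactly at the vectors that are not
cyclic for `g` (over a field), and the set of its values depends only on the conjugacy class. -/
def cyclicForm (g : SL(2, R)) (v : Fin 2 → R) : R :=
  (Matrix.of ![v, g.1 *ᵥ v]).det

theorem trace_companionSL (d : Rˣ) (t : R) : (companionSL d t).1.trace = t := by
  simp [companionSL, Matrix.trace_fin_two]

theorem cyclicForm_eq (g : SL(2, R)) (v : Fin 2 → R) :
    cyclicForm g v = g.1 1 0 * v 0 ^ 2 + (g.1 1 1 - g.1 0 0) * v 0 * v 1 - g.1 0 1 * v 1 ^ 2 := by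
  simp only [cyclicForm, Matrix.mulVec_fin_two, Matrix.det_fin_two, Matrix.of_apply,
    Matrix.cons_val]
  ring

theorem cyclicForm_smul (g : SL(2, R)) (k : R) (v : Fin 2 → R) :
    cyclicForm g (k • v) = k ^ 2 * cyclicForm g v := by
  simp only [cyclicForm_eq, Pi.smul_apply, smul_eq_mul]
  ring

theorem cyclicForm_conj (h g : SL(2, R)) (v : Fin 2 → R) :
    cyclicForm (h * g * h⁻¹) (h.1 *ᵥ v) = cyclicForm g v := by
  have hv : (h * g * h⁻¹).1 *ᵥ (h.1 *ᵥ v) = h.1 *ᵥ (g.1 *ᵥ v) := by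
    rw [Matrix.mulVec_mulVec, Matrix.mulVec_mulVec, ← Matrix.SpecialLinearGroup.coe_mul,
      inv_mul_cancel_right, Matrix.SpecialLinearGroup.coe_mul]
  have hrows : Matrix.of ![h.1 *ᵥ v, h.1 *ᵥ (g.1 *ᵥ v)] = Matrix.of ![v, g.1 *ᵥ v] * h.1ᵀ := by
    ext i j
    fin_cases i <;> fin_cases j <;> simp [Matrix.mul_apply, mul_comm]
  rw [cyclicForm, cyclicForm, hv, hrows, Matrix.det_mul, Matrix.det_transpose, h.2, mul_one]

theorem trace_mul_mul_inv (h g : SL(2, R)) : (h * g * h⁻¹).1.trace = g.1.trace := by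
  rw [Matrix.SpecialLinearGroup.coe_mul, Matrix.trace_mul_comm,
    ← Matrix.SpecialLinearGroup.coe_mul, ← mul_assoc, inv_mul_cancel, one_mul]

theorem cyclicForm_companionSL (d : Rˣ) (t : R) (v : Fin 2 → R) :
    cyclicForm (companionSL d t) v = d * v 0 ^ 2 + t * v 0 * v 1 + ↑d⁻¹ * v 1 ^ 2 := by
  rw [cyclicForm_eq]
  simp [companionSL]

theorem isConj_companionSL_of_cyclicForm_eq {d : Rˣ} {g : SL(2, R)} {v : Fin 2 → R}
    (hv : cyclicForm g v = d) : IsConj (companionSL d g.1.trace) g := by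
  -- The columns of the conjugating matrix are `v` and `d⁻¹ g v`.
  set w := g.1 *ᵥ v with hw
  let P : Matrix (Fin 2) (Fin 2) R := (Matrix.of ![v, (↑d⁻¹ : R) • w])ᵀ
  have hdet : P.det = 1 := by
    have : P.det = ↑d⁻¹ * cyclicForm g v := by
      simp only [P, cyclicForm, ← hw, Matrix.det_transpose, Matrix.det_fin_two, Matrix.of_apply,
        Matrix.cons_val, Pi.smul_apply, smul_eq_mul]
      ring
    rw [this, hv, Units.inv_mul]
  have hgw : g.1 *ᵥ w = g.1.trace • w - v := by
    rw [hw, Matrix.mulVec_mulVec, ← sq, sq_eq_trace_smul_sub_one g.2, Matrix.sub_mulVec,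
      Matrix.smul_mulVec, Matrix.one_mulVec]
  have hcompanion :
      P * (companionSL d g.1.trace).1 = (Matrix.of ![w, (↑d⁻¹ : R) • (g.1 *ᵥ w)])ᵀ := by
    rw [hgw]
    ext i j
    fin_cases j
    · simp [P, companionSL, Matrix.mul_apply, mul_right_comm]
    · simp only [P, companionSL, Fin.mk_one, Matrix.mul_apply, Fin.sum_univ_two,
        Matrix.transpose_apply, Matrix.of_apply, Matrix.cons_val, Pi.smul_apply, Pi.sub_apply,
        smul_eq_mul]
      ring
  have hmul : g.1 * P = (Matrix.of ![w, (↑d⁻¹ : R) • (g.1 *ᵥ w)])ᵀ := by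
    rw [← Matrix.mulVec_smul]
    ext i j
    fin_cases j <;> rfl
  exact isConj_iff.2
    ⟨⟨P, hdet⟩, mul_inv_eq_of_eq_mul (Subtype.ext (hcompanion.trans hmul.symm))⟩

theorem isConj_companionSL_iff {d : Rˣ} {t : R} {g : SL(2, R)} :
    IsConj (companionSL d t) g ↔ g.1.trace = t ∧ ∃ v, cyclicForm g v = d := by
  constructor
  · intro hg
    obtain ⟨h, rfl⟩ := isConj_iff.1 hg
    refine ⟨by rw [trace_mul_mul_inv, trace_companionSL], h.1 *ᵥ ![1, 0], ?_⟩
    rw [cyclicForm_conj, cyclicForm_companionSL]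
    simp
  · rintro ⟨rfl, v, hv⟩
    exact isConj_companionSL_of_cyclicForm_eq hv

theorem isSquare_of_isConj_companionSL_one {d : Rˣ} {e : R} (he : e ^ 2 = 1)
    (h : IsConj (companionSL d (2 * e)) (companionSL 1 (2 * e))) : IsSquare (d : R) := by
  obtain ⟨-, v, hv⟩ := isConj_companionSL_iff.1 h
  rw [cyclicForm_companionSL, inv_one, Units.val_one] at hv
  exact ⟨v 0 + e * v 1, by linear_combination -hv - v 1 ^ 2 * he⟩

theorem exists_eq_smul_one_of_cyclicForm_eq_zero {g : SL(2, R)} (h : ∀ v, cyclicForm g v = 0) :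
    ∃ e : R, g.1 = e • 1 := by
  have h10 : g.1 1 0 = 0 := by simpa [cyclicForm_eq] using h ![1, 0]
  have h01 : g.1 0 1 = 0 := by simpa [cyclicForm_eq] using h ![0, 1]
  have h11 : g.1 1 1 = g.1 0 0 := by simpa [cyclicForm_eq, h10, h01, sub_eq_zero] using h ![1, 1]
  refine ⟨g.1 0 0, ?_⟩
  ext i j
  fin_cases i <;> fin_cases j <;> simp [h10, h01, h11]

theorem cyclicForm_eq_zero_of_eq_smul_one {e : R} {z : SL(2, R)} (hz : z.1 = e • 1)
    (v : Fin 2 → R) : cyclicForm z v = 0 := by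
  simp [cyclicForm_eq, hz]

theorem not_isConj_companionSL_of_eq_smul_one [Nontrivial R] {d : Rˣ} {t e : R} {z : SL(2, R)}
    (hz : z.1 = e • 1) : ¬IsConj (companionSL d t) z := by
  rw [isConj_companionSL_iff]
  rintro ⟨-, v, hv⟩
  exact d.ne_zero (by rw [← hv, cyclicForm_eq_zero_of_eq_smul_one hz])

end Conjugacy

section FiniteField

variable {F : Type*} [Field F] [Finite F]

theorem exists_sq_sub_mul_sq_eq (hF : ringChar F ≠ 2) {D : F} (hD : D ≠ 0) (n : F) :
    ∃ x y : F, x ^ 2 - D * y ^ 2 = n := by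
  have := Fintype.ofFinite F
  obtain ⟨x, y, h⟩ := FiniteField.exists_root_sum_quadratic
    (f := X ^ 2 - Polynomial.C n) (g := Polynomial.C (-D) * X ^ 2)
    (degree_X_pow_sub_C two_pos n) (degree_C_mul_X_pow 2 (neg_ne_zero.2 hD))
    (FiniteField.odd_card_of_char_ne_two hF)
  simp only [eval_sub, eval_mul, eval_pow, eval_X, eval_C] at h
  exact ⟨x, y, by linear_combination h⟩

theorem exists_binary_quadratic_form_eq (hF : ringChar F ≠ 2) {a b c : F}
    (hD : b ^ 2 - 4 * a * c ≠ 0) (n : F) : ∃ x y, a * x ^ 2 + b * x * y + c * y ^ 2 = n := by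
  have h2 : (2 : F) ≠ 0 := Ring.two_ne_zero hF
  obtain rfl | ha := eq_or_ne a 0
  · have hb : b ≠ 0 := by rintro rfl; simp at hD
    exact ⟨(n - c) / b, 1, by field_simp; ring⟩
  · obtain ⟨u, y, hu⟩ := exists_sq_sub_mul_sq_eq hF hD (4 * a * n)
    refine ⟨(u - b * y) / (2 * a), y, ?_⟩
    field_simp
    linear_combination hu

theorem isSquare_div_of_not_isSquare {a b : F} (ha : ¬IsSquare a) (hb : ¬IsSquare b) :
    IsSquare (a / b) := by
  classical
  have := Fintype.ofFinite F
  have ha0 : a ≠ 0 := fun h => ha (h ▸ IsSquare.zero)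
  have hb0 : b ≠ 0 := fun h => hb (h ▸ IsSquare.zero)
  rw [div_eq_mul_inv, ← quadraticChar_one_iff_isSquare (mul_ne_zero ha0 (inv_ne_zero hb0)), map_mul,
    quadraticChar_neg_one_iff_not_isSquare.2 ha,
    quadraticChar_neg_one_iff_not_isSquare.2 (isSquare_inv.not.2 hb)]
  norm_num

theorem isConj_companionSL_one (hF : ringChar F ≠ 2) {g : SL2 F} (hg : g.1.trace ^ 2 - 4 ≠ 0) :
    IsConj (companionSL 1 g.1.trace) g := by
  have hdet := g.2
  rw [Matrix.det_fin_two] at hdet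
  have hD : (g.1 1 1 - g.1 0 0) ^ 2 - 4 * g.1 1 0 * -g.1 0 1 ≠ 0 := by
    convert hg using 1
    rw [Matrix.trace_fin_two]
    linear_combination -4 * hdet
  obtain ⟨x, y, hxy⟩ := exists_binary_quadratic_form_eq hF hD 1
  refine isConj_companionSL_iff.2 ⟨rfl, ![x, y], ?_⟩
  rw [cyclicForm_eq, Units.val_one]
  simpa [sub_eq_add_neg] using hxy

theorem image_mk_trace_eq_of_sq_sub_four_ne_zero (hF : ringChar F ≠ 2) {t : F}
    (ht : t ^ 2 - 4 ≠ 0) :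
    ConjClasses.mk '' {g : SL2 F | g.1.trace = t} = {ConjClasses.mk (companionSL 1 t)} := by
  refine Set.Subset.antisymm ?_ ?_
  · rintro _ ⟨g, rfl, rfl⟩
    exact ConjClasses.mk_eq_mk_iff_isConj.2 (isConj_companionSL_one hF ht).symm
  · rintro _ rfl
    exact ⟨_, trace_companionSL 1 t, rfl⟩

theorem isConj_or_of_cyclicForm_ne_zero {n : Fˣ} (hn : ¬IsSquare (n : F)) {g : SL2 F}
    {v : Fin 2 → F} (hv : cyclicForm g v ≠ 0) :
    IsConj (companionSL 1 g.1.trace) g ∨ IsConj (companionSL n g.1.trace) g := by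
  have key {a : Fˣ} (h : IsSquare (a / cyclicForm g v)) : IsConj (companionSL a g.1.trace) g := by
    obtain ⟨k, hk⟩ := h
    refine isConj_companionSL_iff.2 ⟨rfl, k • v, ?_⟩
    rw [cyclicForm_smul, sq, ← hk, div_mul_cancel₀ _ hv]
  by_cases h : IsSquare (cyclicForm g v)
  · exact .inl (key (by simpa using h))
  · exact .inr (key (isSquare_div_of_not_isSquare hn h))

theorem image_mk_trace_eq_of_eq_smul_one (h2 : (2 : F) ≠ 0) {n : Fˣ} (hn : ¬IsSquare (n : F))
    {e : F} {z : SL2 F} (hz : z.1 = e • 1) :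
    ConjClasses.mk '' {g : SL2 F | g.1.trace = 2 * e} =
      {ConjClasses.mk z, ConjClasses.mk (companionSL 1 (2 * e)),
        ConjClasses.mk (companionSL n (2 * e))} := by
  refine Set.Subset.antisymm ?_ ?_
  · rintro _ ⟨g, hg : g.1.trace = 2 * e, rfl⟩
    simp only [Set.mem_insert_iff, Set.mem_singleton_iff, ConjClasses.mk_eq_mk_iff_isConj,
      isConj_comm (g := g), ← hg]
    by_cases hv : ∀ v, cyclicForm g v = 0
    · obtain ⟨e', he'⟩ := exists_eq_smul_one_of_cyclicForm_eq_zero hv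
      have : e' = e := mul_left_cancel₀ h2 (by simpa [he', mul_comm] using hg)
      exact .inl (by rw [Subtype.ext (hz.trans (this ▸ he').symm)])
    · push Not at hv
      obtain ⟨v, hv⟩ := hv
      exact .inr (isConj_or_of_cyclicForm_ne_zero hn hv)
  · rintro _ (rfl | rfl | rfl)
    · exact ⟨z, by simp [hz, mul_comm], rfl⟩
    · exact ⟨_, trace_companionSL 1 _, rfl⟩
    · exact ⟨_, trace_companionSL n _, rfl⟩

theorem ncard_image_mk_trace_of_eq_smul_one (hF : ringChar F ≠ 2) {e : F} {z : SL2 F}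
    (hz : z.1 = e • 1) : (ConjClasses.mk '' {g : SL2 F | g.1.trace = 2 * e}).ncard = 3 := by
  obtain ⟨n, hn⟩ := FiniteField.exists_nonsquare hF
  lift n to Fˣ using (isUnit_iff_ne_zero.2 fun h => hn (h ▸ IsSquare.zero))
  have he : e ^ 2 = 1 := by simpa [hz] using z.2
  rw [image_mk_trace_eq_of_eq_smul_one (Ring.two_ne_zero hF) hn hz, Set.ncard_eq_three]
  refine ⟨_, _, _, ?_, ?_, ?_, rfl⟩ <;> rw [Ne, ConjClasses.mk_eq_mk_iff_isConj, isConj_comm]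
  · exact not_isConj_companionSL_of_eq_smul_one hz
  · exact not_isConj_companionSL_of_eq_smul_one hz
  · exact fun h => hn (isSquare_of_isConj_companionSL_one he h)

end FiniteField

section TraceFibers

theorem ncard_eq_sum_ncard_fiber {α β : Type*} [Finite α] [Fintype β] (s : Set α) (f : α → β) :
    s.ncard = ∑ b, {a ∈ s | f a = b}.ncard := by
  classical
  have := Fintype.ofFinite α
  simp only [Set.ncard_eq_toFinset_card']
  rw [Finset.card_eq_sum_card_fiberwise (f := f) fun _ _ => mem_univ _]
  refine sum_congr rfl fun b _ => congrArg card ?_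
  ext
  simp

/-- The trace as a class function on `SL₂`. -/
def classTrace {R : Type*} [CommRing R] : ConjClasses SL(2, R) → R :=
  Quotient.lift (fun g => g.1.trace) fun g _ h => by
    obtain ⟨c, rfl⟩ := isConj_iff.1 h
    exact (trace_mul_mul_inv c g).symm

theorem ncard_image_mk_eq_sum {R : Type*} [CommRing R] [Fintype R] (s : Set SL(2, R)) :
    (ConjClasses.mk '' s).ncard = ∑ t, (ConjClasses.mk '' {g ∈ s | g.1.trace = t}).ncard := by
  classical
  rw [ncard_eq_sum_ncard_fiber _ classTrace]
  exact sum_congr rfl fun t _ => congrArg Set.ncard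
    (Set.image_inter_preimage ConjClasses.mk s (classTrace ⁻¹' {t})).symm

theorem powers_of_trace_neg_two {F : Type*} [Field F] [Decidable (IsSquare (2 : F))] :
    {g ∈ nthPowers (SL2 F) 4 | g.1.trace = -2} = if IsSquare (2 : F) then {-1} else ∅ := by
  split_ifs with h
  · obtain ⟨r, hr⟩ := h
    refine Set.eq_singleton_iff_unique_mem.2 ⟨⟨⟨companionSL 1 r, ?_⟩, ?_⟩, ?_⟩
    · exact pow_four_eq_neg_one_of_trace_sq_eq_two (by rw [trace_companionSL, hr, sq])
    · simp
    · rintro _ ⟨⟨x, rfl⟩, hx⟩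
      exact pow_four_eq_neg_one_of_trace_sq_eq_two (trace_pow_four_eq_neg_two_iff.1 hx)
  · refine Set.eq_empty_iff_forall_notMem.2 ?_
    rintro _ ⟨⟨x, rfl⟩, hx⟩
    exact h ⟨x.1.trace, by rw [← sq, trace_pow_four_eq_neg_two_iff.1 hx]⟩

end TraceFibers
section TraceTwo

variable {F : Type*} [Field F]

theorem four_ne_zero_of_ringChar_ne_two (hF : ringChar F ≠ 2) : (4 : F) ≠ 0 := by
  rw [show (4 : F) = 2 ^ 2 by norm_num]
  exact pow_ne_zero 2 (Ring.two_ne_zero hF)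

theorem sq_eq_four_iff {t : F} : t ^ 2 = 4 ↔ t = 2 ∨ t = -2 := by
  rw [← sq_eq_sq_iff_eq_or_eq_neg]
  norm_num

theorem two_ne_neg_two (hF : ringChar F ≠ 2) : (2 : F) ≠ -2 := by
  rw [Ne, eq_neg_iff_add_eq_zero, two_add_two_eq_four]
  exact four_ne_zero_of_ringChar_ne_two hF

theorem ncard_image_mk_trace_eq [Finite F] [DecidableEq F] (hF : ringChar F ≠ 2) (t : F) :
    (ConjClasses.mk '' {g : SL2 F | g.1.trace = t}).ncard = if t ^ 2 = 4 then 3 else 1 := by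
  split_ifs with ht
  · obtain rfl | rfl := sq_eq_four_iff.1 ht
    · simpa using ncard_image_mk_trace_of_eq_smul_one hF (e := 1) (z := 1) (by simp)
    · simpa using ncard_image_mk_trace_of_eq_smul_one hF (e := -1) (z := -1) (by simp)
  · rw [image_mk_trace_eq_of_sq_sub_four_ne_zero hF (sub_ne_zero.2 ht), Set.ncard_singleton]

end TraceTwo


section Counting

variable {F : Type*} [Field F] [Fintype F] [DecidableEq F]

theorem card_filter_sq_eq (hF : ringChar F ≠ 2) (a : F) :
    (#{x : F | x ^ 2 = a} : ℤ) = quadraticChar F a + 1 := by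
  rw [← quadraticChar_card_sqrts hF a]
  congr 2
  ext
  simp

theorem card_filter_quadratic_eq_zero (hF : ringChar F ≠ 2) (b c : F) :
    (#{x : F | x ^ 2 + b * x + c = 0} : ℤ) = quadraticChar F (b ^ 2 - 4 * c) + 1 := by
  have h2 : (2 : F) ≠ 0 := Ring.two_ne_zero hF
  have h4 := four_ne_zero_of_ringChar_ne_two hF
  rw [← card_filter_sq_eq hF]
  refine congrArg _ (card_equiv ((Equiv.mulLeft₀ 2 h2).trans (Equiv.addRight b)) fun x => ?_)
  have hsq : (2 * x + b) ^ 2 - (b ^ 2 - 4 * c) = 4 * (x ^ 2 + b * x + c) := by ring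
  simp [← sub_eq_zero (b := b ^ 2 - 4 * c), hsq, h4]

theorem card_filter_mul_eq (n : F) :
    (#{p : F × F | p.1 * p.2 = n} : ℤ) =
      Fintype.card F - 1 + if n = 0 then (Fintype.card F : ℤ) else 0 := by
  have hfiber (b : F) : (∑ c : F, if b * c = n then (1 : ℤ) else 0) =
      1 + if b = 0 then (if n = 0 then (Fintype.card F : ℤ) else 0) - 1 else 0 := by
    rcases eq_or_ne b 0 with rfl | hb
    · simp [eq_comm]
    · simp [← eq_inv_mul_iff_mul_eq₀ hb, hb]
  rw [card_filter, Fintype.sum_prod_type]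
  push_cast
  simp only [hfiber, sum_add_distrib, sum_ite_eq', mem_univ, if_true, sum_const, card_univ,
    nsmul_one]
  ring

theorem ncard_trace_eq_card_filter (t : F) :
    {g : SL2 F | g.1.trace = t}.ncard =
      #{p : F × F × F | p.2.1 * p.2.2 = p.1 * (t - p.1) - 1} := by
  rw [← Set.ncard_coe_finset]
  refine Set.ncard_congr (fun g _ => (g.1 0 0, g.1 0 1, g.1 1 0)) ?_ ?_ ?_
  · rintro g rfl
    have hdet := g.2
    rw [Matrix.det_fin_two] at hdet
    simp only [coe_filter_univ, Set.mem_ofPred_eq, Matrix.trace_fin_two]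
    linear_combination -hdet
  · intro g h (hg : g.1.trace = t) (hh : h.1.trace = t) hgh
    obtain ⟨h00, h01, h10⟩ : g.1 0 0 = h.1 0 0 ∧ g.1 0 1 = h.1 0 1 ∧ g.1 1 0 = h.1 1 0 := by
      simpa using hgh
    have h11 : g.1 1 1 = h.1 1 1 := by
      rw [Matrix.trace_fin_two] at hg hh
      linear_combination hg - hh - h00
    ext i j
    fin_cases i <;> fin_cases j <;> assumption
  · rintro ⟨a, b, c⟩ habc
    simp only [coe_filter_univ, Set.mem_ofPred_eq] at habc
    have hdet : !![a, b; c, t - a].det = 1 := by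
      rw [Matrix.det_fin_two_of]
      linear_combination -habc
    exact ⟨⟨_, hdet⟩, (Matrix.trace_fin_two_of ..).trans (add_sub_cancel a t), by simp⟩

theorem ncard_trace_eq (hF : ringChar F ≠ 2) (t : F) :
    ({g : SL2 F | g.1.trace = t}.ncard : ℤ) =
      (Fintype.card F : ℤ) ^ 2 + Fintype.card F * quadraticChar F (t ^ 2 - 4) := by
  have hroots : (#{a : F | a * (t - a) - 1 = 0} : ℤ) = quadraticChar F (t ^ 2 - 4) + 1 := by
    have h := card_filter_quadratic_eq_zero hF (-t) 1
    rw [neg_sq, mul_one] at h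
    rw [← h]
    congr! 3 with a
    rw [← neg_eq_zero]
    ring_nf
  have hfiber (a : F) : (∑ p : F × F, if p.1 * p.2 = a * (t - a) - 1 then (1 : ℤ) else 0) =
      Fintype.card F - 1 + if a * (t - a) - 1 = 0 then (Fintype.card F : ℤ) else 0 := by
    rw [← card_filter_mul_eq, card_filter]
    push_cast
    rfl
  rw [ncard_trace_eq_card_filter, card_filter, Fintype.sum_prod_type]
  push_cast
  simp only [hfiber, sum_add_distrib, ← sum_filter, sum_const, nsmul_eq_mul, hroots, card_univ]
  ring

theorem sum_quadraticChar_sq_sub_four (hF : ringChar F ≠ 2) :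
    ∑ t : F, quadraticChar F (t ^ 2 - 4) = -1 := by
  have h4 := four_ne_zero_of_ringChar_ne_two hF
  have hχ (x : F) : quadraticChar F ((2 - 4 * x) ^ 2 - 4) =
      quadraticChar F (-1) * (quadraticChar F x * quadraticChar F (1 - x)) := by
    rw [show (2 - 4 * x) ^ 2 - 4 = 4 ^ 2 * (-1 * (x * (1 - x))) by ring, map_mul,
      quadraticChar_sq_one' h4, one_mul, map_mul, map_mul]
  have hjacobi := jacobiSum_nontrivial_inv (quadraticChar_ne_one hF)
  rw [(quadraticChar_isQuadratic F).inv, jacobiSum] at hjacobi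
  rw [← Fintype.sum_equiv ((Equiv.mulLeft₀ 4 h4).trans (Equiv.subLeft 2))
    (fun x => quadraticChar F ((2 - 4 * x) ^ 2 - 4)) _ fun _ => rfl]
  simp only [hχ, ← mul_sum, hjacobi]
  rw [mul_neg, ← sq, quadraticChar_sq_one (neg_ne_zero.2 one_ne_zero)]

theorem filter_sq_eq_four : ({t | t ^ 2 = 4} : Finset F) = {2, -2} := by
  ext t
  simp [sq_eq_four_iff]

theorem card_filter_sq_eq_four (hF : ringChar F ≠ 2) : #{t : F | t ^ 2 = 4} = 2 := by
  rw [filter_sq_eq_four, card_pair (two_ne_neg_two hF)]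

end Counting

section GroupOrder

variable {F : Type*} [Field F] [Fintype F]

theorem natCard_SL2 (hF : ringChar F ≠ 2) :
    (Nat.card (SL2 F) : ℤ) = (Fintype.card F : ℤ) ^ 3 - Fintype.card F := by
  classical
  rw [← Set.ncard_univ, ncard_eq_sum_ncard_fiber _ fun g : SL2 F => g.1.trace, Nat.cast_sum]
  simp only [Set.mem_univ, true_and, ncard_trace_eq hF, sum_add_distrib, ← mul_sum,
    sum_quadraticChar_sq_sub_four hF, sum_const, card_univ, nsmul_eq_mul]
  ring

theorem natCard_conjClasses_SL2 (hF : ringChar F ≠ 2) :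
    Nat.card (ConjClasses (SL2 F)) = Fintype.card F + 4 := by
  classical
  have hsum (t : F) : (if t ^ 2 = 4 then 3 else 1) = 1 + if t ^ 2 = 4 then 2 else 0 := by
    split_ifs <;> rfl
  rw [← Set.ncard_univ, ← Set.image_univ_of_surjective ConjClasses.mk_surjective,
    ncard_image_mk_eq_sum]
  simp only [Set.mem_univ, true_and, ncard_image_mk_trace_eq hF, hsum, sum_add_distrib, sum_const,
    card_univ, ← sum_filter, card_filter_sq_eq_four hF, smul_eq_mul, mul_one]

end GroupOrder

section TraceValues

variable (F : Type*) [Field F] [Fintype F] [DecidableEq F]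

/-- The traces of the noncentral semisimple elements of `SL₂(F)` whose eigenvalues lie in `F`
(`e = 1`, the split torus) or outside `F` (`e = -1`, the nonsplit torus), read off from the
discriminant `t ^ 2 - 4` of the characteristic polynomial. -/
def torusTraces (e : ℤˣ) : Finset F := {t | quadraticChar F (t ^ 2 - 4) = e}

/-- The elements of `torusTraces F e` that are traces of `n`-th powers, encoded as values of the
Chebyshev polynomial `C_n`. -/
noncomputable def powerTraces (n : ℕ) (e : ℤˣ) : Finset F :=
  {t ∈ torusTraces F e | ∃ s, (C F n).eval s = t}

variable {F} {e : ℤˣ} {s t : F}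

theorem mem_torusTraces : t ∈ torusTraces F e ↔ quadraticChar F (t ^ 2 - 4) = e := by
  simp [torusTraces]

theorem sq_sub_four_ne_zero_of_mem_torusTraces (ht : t ∈ torusTraces F e) : t ^ 2 - 4 ≠ 0 := by
  rw [mem_torusTraces] at ht
  intro h
  rw [h, MulChar.map_zero] at ht
  exact e.ne_zero ht.symm

theorem eval_C_mem_torusTraces_iff {n : ℤ} :
    (C F n).eval s ∈ torusTraces F e ↔ s ∈ torusTraces F e ∧ (S F (n - 1)).eval s ≠ 0 := by
  rw [mem_torusTraces, mem_torusTraces, eval_C_sq_sub_four, map_mul, map_pow]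
  by_cases hS : (S F (n - 1)).eval s = 0
  · simp [hS, e.ne_zero.symm]
  · rw [quadraticChar_sq_one hS, one_mul, and_iff_left hS]

theorem powerTraces_eq_image (n : ℕ) (e : ℤˣ) :
    powerTraces F n e =
      image (C F n).eval {s ∈ torusTraces F e | (S F (n - 1)).eval s ≠ 0} := by
  ext t
  simp only [powerTraces, mem_filter, mem_image, ← eval_C_mem_torusTraces_iff]
  constructor
  · rintro ⟨ht, s, rfl⟩
    exact ⟨s, ht, rfl⟩
  · rintro ⟨s, hs, rfl⟩
    exact ⟨hs, s, rfl⟩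

theorem two_mul_ite_quadraticChar_eq (a : F) (e : ℤˣ) :
    2 * (if quadraticChar F a = e then 1 else 0) =
      quadraticChar F a ^ 2 + e * quadraticChar F a := by
  rcases eq_or_ne a 0 with rfl | ha
  · simp [e.ne_zero.symm]
  · rcases quadraticChar_dichotomy ha with h | h <;> rcases Int.units_eq_one_or e with rfl | rfl <;>
      simp [h]

theorem sum_quadraticChar_sq_sub_four_sq (hF : ringChar F ≠ 2) :
    ∑ t : F, quadraticChar F (t ^ 2 - 4) ^ 2 = Fintype.card F - 2 := by
  have hχ (t : F) : quadraticChar F (t ^ 2 - 4) ^ 2 = 1 - if t ^ 2 = 4 then 1 else 0 := by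
    split_ifs with ht
    · simp [ht]
    · rw [quadraticChar_sq_one (sub_ne_zero.2 ht), sub_zero]
  simp only [hχ, sum_sub_distrib, sum_const, nsmul_one, sum_boole, card_filter_sq_eq_four hF,
    card_univ, Nat.cast_ofNat]

theorem two_mul_card_torusTraces (hF : ringChar F ≠ 2) (e : ℤˣ) :
    2 * (#(torusTraces F e) : ℤ) = Fintype.card F - 2 - e := by
  rw [torusTraces, card_filter, Nat.cast_sum, mul_sum]
  push_cast
  simp only [two_mul_ite_quadraticChar_eq, sum_add_distrib, ← mul_sum,
    sum_quadraticChar_sq_sub_four hF, sum_quadraticChar_sq_sub_four_sq hF]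
  ring

theorem sum_eq_sum_torusTraces (hF : ringChar F ≠ 2) {M : Type*} [AddCommMonoid M] (f : F → M) :
    ∑ t, f t = f 2 + f (-2) + ∑ t ∈ torusTraces F 1, f t + ∑ t ∈ torusTraces F (-1), f t := by
  have hmaps (t : F) (_ : t ∈ univ) : quadraticChar F (t ^ 2 - 4) ∈ ({0, 1, -1} : Finset ℤ) := by
    simpa using quadraticChar_isQuadratic F (t ^ 2 - 4)
  have hzero : ({t | quadraticChar F (t ^ 2 - 4) = 0} : Finset F) = {2, -2} := by
    simp only [quadraticChar_eq_zero_iff, sub_eq_zero, filter_sq_eq_four]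
  rw [← sum_fiberwise_of_maps_to hmaps, sum_insert (by decide), sum_insert (by decide),
    sum_singleton, hzero, sum_pair (two_ne_neg_two hF), ← add_assoc]
  simp [torusTraces]

theorem sum_powers_of_trace (hF : ringChar F ≠ 2) {n : ℕ} (hn : (n : F) ≠ 0)
    {M : Type*} [AddCommMonoid M] {f : Set (SL2 F) → M} (hf : f ∅ = 0) :
    ∑ t, f {g ∈ nthPowers (SL2 F) n | g.1.trace = t} =
      f {g | g.1.trace = 2} + f {g ∈ nthPowers (SL2 F) n | g.1.trace = -2} +
        ∑ t ∈ powerTraces F n 1, f {g | g.1.trace = t} +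
        ∑ t ∈ powerTraces F n (-1), f {g | g.1.trace = t} := by
  have htwo : {g ∈ nthPowers (SL2 F) n | g.1.trace = 2} = {g | g.1.trace = 2} :=
    Set.sep_eq_of_subset fun g hg => mem_nthPowers_of_trace_eq_two hn hg
  have htorus (e : ℤˣ) : ∑ t ∈ torusTraces F e, f {g ∈ nthPowers (SL2 F) n | g.1.trace = t} =
      ∑ t ∈ powerTraces F n e, f {g | g.1.trace = t} := by
    rw [powerTraces, sum_filter]
    refine sum_congr rfl fun t ht => ?_
    have ht4 := sq_sub_four_ne_zero_of_mem_torusTraces ht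
    split_ifs with hs
    · congr 1
      refine Set.sep_eq_of_subset fun g hg => ?_
      obtain rfl : g.1.trace = t := hg
      exact (mem_nthPowers_iff_of_trace_sq_sub_four_ne_zero ht4).2 hs
    · convert hf
      refine Set.eq_empty_iff_forall_notMem.2 ?_
      rintro g ⟨hg, rfl⟩
      exact hs (exists_eval_C_eq_trace hg)
  rw [sum_eq_sum_torusTraces hF, htwo, htorus, htorus]

end TraceValues

section FourthPowerTraces

variable {F : Type*} [Field F] [Fintype F] [DecidableEq F] {e : ℤˣ}

theorem quadraticChar_four_sub_sq {s : F} (hs : s ∈ torusTraces F e) :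
    quadraticChar F (4 - s ^ 2) = quadraticChar F (-1) * e := by
  rw [← mem_torusTraces.1 hs, ← map_mul]
  ring_nf

theorem card_filter_eval_C_four_eq (hF : ringChar F ≠ 2) {s : F} (hs : s ∈ torusTraces F e)
    (hS : (S F 3).eval s ≠ 0) :
    (#{x : F | (C F 4).eval x = (C F 4).eval s} : ℤ) = 3 + quadraticChar F (-1) * e := by
  rw [eval_S_three] at hS
  have hs0 : s ≠ 0 := left_ne_zero_of_mul hS
  have hfactor (x : F) : (C F 4).eval x = (C F 4).eval s ↔ x ^ 2 = s ^ 2 ∨ x ^ 2 = 4 - s ^ 2 := by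
    rw [← sub_eq_zero, ← sub_eq_zero (a := x ^ 2), ← sub_eq_zero (b := 4 - s ^ 2), ← mul_eq_zero,
      eval_C_four, eval_C_four]
    ring_nf
  have hdisj : Disjoint ({x | x ^ 2 = s ^ 2} : Finset F) ({x | x ^ 2 = 4 - s ^ 2} : Finset F) := by
    refine disjoint_filter.2 fun x _ hx hx' => hS ?_
    have h2 : 2 * (s ^ 2 - 2) = 0 := by linear_combination hx' - hx
    rw [(mul_eq_zero.1 h2).resolve_left (Ring.two_ne_zero hF), mul_zero]
  rw [filter_congr fun x _ => hfactor x, filter_or, card_union_of_disjoint hdisj, Nat.cast_add,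
    card_filter_sq_eq hF, card_filter_sq_eq hF, quadraticChar_four_sub_sq hs,
    quadraticChar_sq_one' hs0]
  ring

theorem card_filter_eval_S_three_ne_zero (hF : ringChar F ≠ 2) (e : ℤˣ) :
    (#{s ∈ torusTraces F e | (S F 3).eval s ≠ 0} : ℤ) =
      (3 + quadraticChar F (-1) * e) * #(powerTraces F 4 e) := by
  have himage : powerTraces F 4 e =
      image (C F 4).eval {s ∈ torusTraces F e | (S F 3).eval s ≠ 0} := powerTraces_eq_image 4 e
  rw [himage, card_eq_sum_card_image (C F 4).eval, Nat.cast_sum, mul_comm, ← nsmul_eq_mul]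
  refine sum_eq_card_nsmul fun t ht => ?_
  obtain ⟨s, hs, rfl⟩ := mem_image.1 ht
  rw [mem_filter] at hs
  rw [← card_filter_eval_C_four_eq hF hs.1 hs.2]
  congr 2
  ext x
  simp only [mem_filter, mem_univ, true_and, and_iff_right_iff_imp]
  intro hx
  have hmem : (C F 4).eval s ∈ torusTraces F e := eval_C_mem_torusTraces_iff.2 hs
  rw [← hx] at hmem
  exact eval_C_mem_torusTraces_iff.1 hmem

theorem two_mul_card_filter_eval_S_three_eq_zero (hF : ringChar F ≠ 2) (e : ℤˣ) :
    2 * (#{s ∈ torusTraces F e | (S F 3).eval s = 0} : ℤ) =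
      (1 + quadraticChar F (-1) * e) * (2 + quadraticChar F 2) := by
  have h2 : (2 : F) ≠ 0 := Ring.two_ne_zero hF
  have hroots : ({s | (S F 3).eval s = 0} : Finset F) = insert 0 ({s | s ^ 2 = 2} : Finset F) := by
    ext s
    simp [eval_S_three, sub_eq_zero]
  have hzero : quadraticChar F (0 ^ 2 - 4) = quadraticChar F (-1) := by
    rw [show (0 : F) ^ 2 - 4 = -1 * 2 ^ 2 by norm_num, map_mul, quadraticChar_sq_one' h2, mul_one]
  have hsqrt (s : F) (hs : s ^ 2 = 2) : quadraticChar F (s ^ 2 - 4) = quadraticChar F (-2) := by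
    rw [hs]
    norm_num
  have hη := quadraticChar_sq_one h2
  rw [torusTraces, filter_comm, hroots, card_filter, sum_insert (by simp [h2.symm]), hzero,
    sum_congr rfl fun s hs => by rw [hsqrt s (mem_filter.1 hs).2], sum_const]
  push_cast [smul_eq_mul, card_filter_sq_eq hF]
  have hδ := two_mul_ite_quadraticChar_eq (-1 : F) e
  have hδη := two_mul_ite_quadraticChar_eq (-2 : F) e
  rw [quadraticChar_sq_one (neg_ne_zero.2 one_ne_zero)] at hδ
  rw [quadraticChar_sq_one (neg_ne_zero.2 h2), neg_eq_neg_one_mul (2 : F), map_mul] at hδη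
  rw [neg_eq_neg_one_mul (2 : F), map_mul]
  linear_combination hδ + (quadraticChar F 2 + 1) * hδη + quadraticChar F (-1) * e * hη

theorem two_mul_card_powerTraces_four (hF : ringChar F ≠ 2) (e : ℤˣ) :
    2 * (3 + quadraticChar F (-1) * e) * #(powerTraces F 4 e) =
      Fintype.card F - 2 - e - (1 + quadraticChar F (-1) * e) * (2 + quadraticChar F 2) := by
  rw [← two_mul_card_torusTraces hF, ← two_mul_card_filter_eval_S_three_eq_zero hF, mul_assoc,
    ← card_filter_eval_S_three_ne_zero hF, ← card_filter_add_card_filter_not (s := torusTraces F e)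
      fun s => (S F 3).eval s = 0]
  push_cast
  ring

end FourthPowerTraces

section PowerCounts

variable {F : Type*} [Field F] [Fintype F] [DecidableEq F]

theorem ncard_trace_eq_of_mem_powerTraces (hF : ringChar F ≠ 2) {n : ℕ} {e : ℤˣ} {t : F}
    (ht : t ∈ powerTraces F n e) :
    ({g : SL2 F | g.1.trace = t}.ncard : ℤ) = (Fintype.card F : ℤ) ^ 2 + Fintype.card F * e := by
  rw [ncard_trace_eq hF, mem_torusTraces.1 (mem_filter.1 ht).1]

theorem ncard_image_mk_trace_eq_of_mem_powerTraces (hF : ringChar F ≠ 2) {n : ℕ} {e : ℤˣ} {t : F}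
    (ht : t ∈ powerTraces F n e) : (ConjClasses.mk '' {g : SL2 F | g.1.trace = t}).ncard = 1 := by
  rw [ncard_image_mk_trace_eq hF, if_neg]
  exact sub_ne_zero.1 (sq_sub_four_ne_zero_of_mem_torusTraces (mem_filter.1 ht).1)

theorem powerCount_eq (hF : ringChar F ≠ 2) {n : ℕ} (hn : (n : F) ≠ 0) :
    (powerCount n F : ℤ) =
      (Fintype.card F : ℤ) ^ 2 + {g ∈ nthPowers (SL2 F) n | g.1.trace = -2}.ncard +
        #(powerTraces F n 1) * ((Fintype.card F : ℤ) ^ 2 + Fintype.card F) +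
        #(powerTraces F n (-1)) * ((Fintype.card F : ℤ) ^ 2 - Fintype.card F) := by
  have htwo : (2 : F) ^ 2 - 4 = 0 := by norm_num
  rw [powerCount, ncard_eq_sum_ncard_fiber _ fun g : SL2 F => g.1.trace,
    sum_powers_of_trace hF hn (Set.ncard_empty _)]
  push_cast
  rw [ncard_trace_eq hF, htwo, sum_congr rfl fun t => ncard_trace_eq_of_mem_powerTraces hF,
    sum_congr rfl fun t => ncard_trace_eq_of_mem_powerTraces hF, sum_const, sum_const]
  simp [sub_eq_add_neg]

theorem powerClassCount_eq (hF : ringChar F ≠ 2) {n : ℕ} (hn : (n : F) ≠ 0) :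
    powerClassCount n F =
      3 + (ConjClasses.mk '' {g ∈ nthPowers (SL2 F) n | g.1.trace = -2}).ncard +
        #(powerTraces F n 1) + #(powerTraces F n (-1)) := by
  have hclasses : nthPowerClasses (SL2 F) n = ConjClasses.mk '' nthPowers (SL2 F) n := rfl
  rw [powerClassCount, hclasses, ncard_image_mk_eq_sum,
    sum_powers_of_trace hF hn (f := fun s => (ConjClasses.mk '' s).ncard) (by simp),
    ncard_image_mk_trace_eq hF, if_pos (by norm_num),
    sum_congr rfl fun t => ncard_image_mk_trace_eq_of_mem_powerTraces hF,
    sum_congr rfl fun t => ncard_image_mk_trace_eq_of_mem_powerTraces hF, sum_const, sum_const]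
  simp only [smul_eq_mul, mul_one]

theorem two_mul_ite_isSquare_two (hF : ringChar F ≠ 2) :
    2 * (if IsSquare (2 : F) then 1 else 0) = 1 + quadraticChar F 2 := by
  have h2 : (2 : F) ≠ 0 := Ring.two_ne_zero hF
  have h := two_mul_ite_quadraticChar_eq (2 : F) 1
  simp only [Units.val_one, quadraticChar_one_iff_isSquare h2, quadraticChar_sq_one h2,
    one_mul] at h
  exact h

theorem two_mul_ncard_powers_of_trace_neg_two (hF : ringChar F ≠ 2) :
    2 * ({g ∈ nthPowers (SL2 F) 4 | g.1.trace = -2}.ncard : ℤ) = 1 + quadraticChar F 2 := by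
  rw [powers_of_trace_neg_two, ← two_mul_ite_isSquare_two hF]
  split_ifs <;> simp

theorem two_mul_ncard_image_mk_powers_of_trace_neg_two (hF : ringChar F ≠ 2) :
    2 * ((ConjClasses.mk '' {g ∈ nthPowers (SL2 F) 4 | g.1.trace = -2}).ncard : ℤ) =
      1 + quadraticChar F 2 := by
  rw [powers_of_trace_neg_two, ← two_mul_ite_isSquare_two hF]
  split_ifs <;> simp

theorem sixteen_mul_card_powerTraces_four (hF : ringChar F ≠ 2) (e : ℤˣ) :
    16 * (#(powerTraces F 4 e) : ℤ) =
      (3 - quadraticChar F (-1) * e) * (Fintype.card F - 2 - e) -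
        2 * (1 + quadraticChar F (-1) * e) * (2 + quadraticChar F 2) := by
  have hδ : quadraticChar F (-1) ^ 2 = 1 := quadraticChar_sq_one (neg_ne_zero.2 one_ne_zero)
  have he : (e : ℤ) ^ 2 = 1 := congrArg Units.val (Int.units_sq e)
  have hδe : (quadraticChar F (-1) * e) ^ 2 = 1 := by rw [mul_pow, hδ, he, one_mul]
  linear_combination (3 - quadraticChar F (-1) * e) * two_mul_card_powerTraces_four hF e +
    (2 * #(powerTraces F 4 e) + 2 + quadraticChar F 2) * hδe

end PowerCounts

section ClosedForms

open ZMod (χ₄ χ₈)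

variable {F : Type*} [Field F] [Finite F]

theorem ringChar_ne_two_of_odd_card (hq : Odd (Nat.card F)) : ringChar F ≠ 2 := by
  have := Fintype.ofFinite F
  rw [Nat.card_eq_fintype_card, Nat.odd_iff] at hq
  exact fun h => by simp [FiniteField.even_card_iff_char_two.1 h] at hq

theorem mod_eight_and_χ₄_and_χ₈_of_odd {q : ℕ} (hq : Odd q) :
    q % 8 = 1 ∧ χ₄ q = 1 ∧ χ₈ q = 1 ∨ q % 8 = 3 ∧ χ₄ q = -1 ∧ χ₈ q = -1 ∨
      q % 8 = 5 ∧ χ₄ q = 1 ∧ χ₈ q = -1 ∨ q % 8 = 7 ∧ χ₄ q = -1 ∧ χ₈ q = 1 := by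
  rw [Nat.odd_iff] at hq
  rw [ZMod.χ₄_nat_eq_if_mod_four, ZMod.χ₈_nat_eq_if_mod_eight]
  grind

theorem eight_mul_powerCount_four (hq : Odd (Nat.card F)) :
    8 * (powerCount 4 F : ℤ) = 3 * ((Nat.card F : ℤ) ^ 3 - Nat.card F) -
      2 * (1 + χ₈ (Nat.card F)) * ((Nat.card F : ℤ) ^ 2 + χ₄ (Nat.card F) * Nat.card F - 2) := by
  classical
  have := Fintype.ofFinite F
  have hF := ringChar_ne_two_of_odd_card hq
  have hsplit := sixteen_mul_card_powerTraces_four hF 1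
  have hnonsplit := sixteen_mul_card_powerTraces_four hF (-1)
  have hneg := two_mul_ncard_powers_of_trace_neg_two hF
  rw [powerCount_eq hF (by exact_mod_cast four_ne_zero_of_ringChar_ne_two hF),
    Nat.card_eq_fintype_card, ← quadraticChar_two hF, ← quadraticChar_neg_one hF]
  push_cast at hsplit hnonsplit
  set q : ℤ := (Fintype.card F : ℤ)
  refine mul_left_cancel₀ two_ne_zero ?_
  linear_combination 8 * hneg + (q ^ 2 + q) * hsplit + (q ^ 2 - q) * hnonsplit

theorem eight_mul_powerClassCount_four (hq : Odd (Nat.card F)) :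
    8 * (powerClassCount 4 F : ℤ) =
      3 * Nat.card F + 18 + χ₄ (Nat.card F) + 2 * χ₈ (Nat.card F) := by
  classical
  have := Fintype.ofFinite F
  have hF := ringChar_ne_two_of_odd_card hq
  have hsplit := sixteen_mul_card_powerTraces_four hF 1
  have hnonsplit := sixteen_mul_card_powerTraces_four hF (-1)
  have hneg := two_mul_ncard_image_mk_powers_of_trace_neg_two hF
  rw [powerClassCount_eq hF (by exact_mod_cast four_ne_zero_of_ringChar_ne_two hF),
    Nat.card_eq_fintype_card, ← quadraticChar_two hF, ← quadraticChar_neg_one hF]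
  push_cast at hsplit hnonsplit ⊢
  linarith

theorem three_le_natCard (hq : Odd (Nat.card F)) : 3 ≤ Nat.card F := by
  have := Finite.one_lt_card (α := F)
  obtain ⟨k, hk⟩ := hq
  omega

theorem abs_div_sub_three_eighths_le {a b q : ℝ} (hb : 0 < b) (hq : 0 < q)
    (h : |8 * a - 3 * b| * q ≤ 2 * (8 * b)) : |a / b - 3 / 8| ≤ 2 / q := by
  have hdiff : a / b - 3 / 8 = (8 * a - 3 * b) / (8 * b) := by field_simp
  have h8b : 0 < 8 * b := by positivity
  rwa [hdiff, abs_div, abs_of_pos h8b, div_le_div_iff₀ h8b hq]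

theorem abs_powerCount_four_div_sub_le (hq : Odd (Nat.card F)) :
    |(powerCount 4 F : ℝ) / Nat.card (SL2 F) - 3 / 8| ≤ 2 / Nat.card F := by
  have := Fintype.ofFinite F
  have h3 : (3 : ℝ) ≤ Nat.card F := mod_cast three_le_natCard hq
  have hcount := congrArg (Int.cast : ℤ → ℝ) (eight_mul_powerCount_four hq)
  have hcard := congrArg (Int.cast : ℤ → ℝ) (natCard_SL2 (ringChar_ne_two_of_odd_card hq))
  rw [← Nat.card_eq_fintype_card] at hcard
  push_cast at hcount hcard
  have hbound : |8 * (powerCount 4 F : ℝ) - 3 * Nat.card (SL2 F)| ≤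
      4 * ((Nat.card F : ℝ) ^ 2 + Nat.card F) := by
    rw [hcount, hcard, abs_le]
    rcases mod_eight_and_χ₄_and_χ₈_of_odd hq with
      ⟨-, h4, h8⟩ | ⟨-, h4, h8⟩ | ⟨-, h4, h8⟩ | ⟨-, h4, h8⟩ <;>
    · rw [h4, h8]
      push_cast
      constructor <;> nlinarith
  generalize (Nat.card F : ℝ) = q at *
  refine abs_div_sub_three_eighths_le (by rw [hcard]; nlinarith) (by linarith) ?_
  calc |8 * (powerCount 4 F : ℝ) - 3 * Nat.card (SL2 F)| * q
      ≤ 4 * (q ^ 2 + q) * q := by gcongr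
    _ ≤ 2 * (8 * Nat.card (SL2 F)) := by rw [hcard]; nlinarith

theorem abs_powerClassCount_four_div_sub_le (hq : Odd (Nat.card F)) :
    |(powerClassCount 4 F : ℝ) / Nat.card (ConjClasses (SL2 F)) - 3 / 8| ≤ 2 / Nat.card F := by
  have := Fintype.ofFinite F
  have hcount := congrArg (Int.cast : ℤ → ℝ) (eight_mul_powerClassCount_four hq)
  have hcard := natCard_conjClasses_SL2 (ringChar_ne_two_of_odd_card hq)
  rw [← Nat.card_eq_fintype_card] at hcard
  push_cast at hcount
  have hbound : |8 * (powerClassCount 4 F : ℝ) - 3 * Nat.card (ConjClasses (SL2 F))| ≤ 9 := by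
    rw [hcount, hcard, abs_le]
    rcases mod_eight_and_χ₄_and_χ₈_of_odd hq with
      ⟨-, h4, h8⟩ | ⟨-, h4, h8⟩ | ⟨-, h4, h8⟩ | ⟨-, h4, h8⟩ <;>
    · rw [h4, h8]
      push_cast
      constructor <;> linarith
  have hpos : 0 < (Nat.card F : ℝ) := Nat.cast_pos.2 Nat.card_pos
  refine abs_div_sub_three_eighths_le (Nat.cast_pos.2 Nat.card_pos) hpos ?_
  calc |8 * (powerClassCount 4 F : ℝ) - 3 * Nat.card (ConjClasses (SL2 F))| * Nat.card F
      ≤ 9 * Nat.card F := by gcongr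
    _ ≤ 2 * (8 * Nat.card (ConjClasses (SL2 F))) := by
      rw [hcard]
      push_cast
      linarith

end ClosedForms

end

theorem corollary7p7 :
    -- the exact formulas for `s(4, q)` and `c(4, q)`
    (∀ (F : Type*) [Field F] [Finite F] (q : ℕ), Nat.card F = q → Odd q →
      ((q % 8 = 1 →
          (powerCount 4 F : ℚ) = 3 / 8 * (q : ℚ) ^ 3 - 1 / 2 * (q : ℚ) ^ 2 - 7 / 8 * (q : ℚ) + 1) ∧
        (q % 8 = 3 ∨ q % 8 = 5 →
          (powerCount 4 F : ℚ) = 3 / 8 * ((q : ℚ) ^ 3 - (q : ℚ))) ∧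
        (q % 8 = 7 →
          (powerCount 4 F : ℚ) = 3 / 8 * (q : ℚ) ^ 3 - 1 / 2 * (q : ℚ) ^ 2 + 1 / 8 * (q : ℚ) + 1)) ∧
      ((q % 8 = 1 → (powerClassCount 4 F : ℚ) = (3 * (q : ℚ) + 21) / 8) ∧
        (q % 8 = 3 → (powerClassCount 4 F : ℚ) = (3 * (q : ℚ) + 15) / 8) ∧
        (q % 8 = 5 → (powerClassCount 4 F : ℚ) = (3 * (q : ℚ) + 17) / 8) ∧
        (q % 8 = 7 → (powerClassCount 4 F : ℚ) = (3 * (q : ℚ) + 19) / 8))) ∧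
    -- the proportion of fourth powers tends to `3 / 8` as the odd prime power `q` tends to infinity
    (∀ ε : ℝ, 0 < ε → ∃ N : ℕ, ∀ (F : Type*) [Field F] [Finite F],
      Odd (Nat.card F) → N ≤ Nat.card F →
        |(powerCount 4 F : ℝ) / (Nat.card (SL2 F) : ℝ) - 3 / 8| < ε) ∧
    -- so does the proportion of conjugacy classes that are fourth powers
    (∀ ε : ℝ, 0 < ε → ∃ N : ℕ, ∀ (F : Type*) [Field F] [Finite F],
      Odd (Nat.card F) → N ≤ Nat.card F →
        |(powerClassCount 4 F : ℝ) / (Nat.card (ConjClasses (SL2 F)) : ℝ) - 3 / 8| < ε) := by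
  refine ⟨fun F _ _ q hcard hq => ?_, fun ε hε => ?_, fun ε hε => ?_⟩
  · subst hcard
    have hs := congrArg (Int.cast : ℤ → ℚ) (eight_mul_powerCount_four hq)
    have hc := congrArg (Int.cast : ℤ → ℚ) (eight_mul_powerClassCount_four hq)
    rcases mod_eight_and_χ₄_and_χ₈_of_odd hq with
      ⟨h, h4, h8⟩ | ⟨h, h4, h8⟩ | ⟨h, h4, h8⟩ | ⟨h, h4, h8⟩ <;>
    · rw [h4, h8] at hs hc
      push_cast at hs hc
      refine ⟨⟨?_, ?_, ?_⟩, ?_, ?_, ?_, ?_⟩ <;> intro hmod <;> first | omega | linarith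
  · obtain ⟨N, hN⟩ := Filter.eventually_atTop.1
      ((tendsto_const_div_atTop_nhds_zero_nat (2 : ℝ)).eventually_lt_const hε)
    exact ⟨N, fun F _ _ hq hNF => (abs_powerCount_four_div_sub_le hq).trans_lt (hN _ hNF)⟩
  · obtain ⟨N, hN⟩ := Filter.eventually_atTop.1
      ((tendsto_const_div_atTop_nhds_zero_nat (2 : ℝ)).eventually_lt_const hε)
    exact ⟨N, fun F _ _ hq hNF => (abs_powerClassCount_four_div_sub_le hq).trans_lt (hN _ hNF)⟩
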